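/- Let $(R,\mathfrak m)$ be a one-dimensional Cohen–Macaulay (in particular Noetherian, commutative) local ring that is not Gorenstein and that has a canonical module $\omega_R$, that is, a maximal Cohen–Macaulay $R$-module of finite injective dimension and of type $1$. Let $$\mathrm{tr}_R(\omega_R)=\sum_{f\in \mathrm{Hom}_R(\omega_R,R)}\mathrm{Im}\, f\subseteq R$$ be its trace ideal. For a subring $S\subseteq R$, call the extension $S\subseteq R$ birational if $\mathrm{Q}(S)=\mathrm{Q}(R)$ (equality of total rings of fractions, via the inclusion $S \subseteq R$) and $R$ is finitely generated as an $S$-module. Let $$bg(R)=\inf\{\ell_S(R/S) : S \text{ is a Gorenstein ring such that } S\subseteq R \text{ is a birational extension}\}\in\mathbb N\cup\{\infty\}$$ be the birational Gorenstein colength of $R$ (with $\inf\emptyset=\infty$), where $\ell$ denotes length. Then $$\ell_R(R/\mathrm{tr}_R(\omega_R))\le 2\, bg(R)-1 ,$$ where the inequality is understood to hold trivially if $bg(R)=\infty$. -/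

import Mathlib

open CategoryTheory

universe u

namespace CanonicalTrace

/-- A commutative ring is Gorenstein if it is Noetherian and each of its localizations at a
prime ideal has finite injective dimension as a module over itself. -/
def IsGorensteinRing (S : Type u) [CommRing S] : Prop :=
  IsNoetherianRing S ∧ ∀ (p : Ideal S) [p.IsPrime], ∃ n : ℕ,
    HasInjectiveDimensionLE
      (ModuleCat.of (Localization.AtPrime p) (Localization.AtPrime p)) n

/-- A finitely generated module `M` over a (Noetherian) local ring `R` is maximal Cohen-Macaulay
if the maximal ideal contains an `M`-regular sequence of length `dim R`, i.e. if
`depth M = dim R`. (Mathlib's `IsRegular` includes `M / (rs) M ≠ 0`.) -/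
def IsMaximalCohenMacaulay (R : Type u) [CommRing R] [IsLocalRing R]
    (M : Type u) [AddCommGroup M] [Module R M] : Prop :=
  Module.Finite R M ∧ ∃ rs : List R,
    (∀ r ∈ rs, r ∈ IsLocalRing.maximalIdeal R) ∧
    RingTheory.Sequence.IsRegular M rs ∧
    ringKrullDim R = (rs.length : WithBot ℕ∞)

/-- A local ring is Cohen-Macaulay if it is Noetherian and its depth equals its dimension. -/
def IsCohenMacaulayLocalRing (R : Type u) [CommRing R] [IsLocalRing R] : Prop :=
  IsNoetherianRing R ∧ IsMaximalCohenMacaulay R R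

/-- A canonical module of a Cohen-Macaulay local ring `R` of dimension `d` with residue field
`k`: a maximal Cohen-Macaulay module `ω` of finite injective dimension and of type one, the
latter meaning that `Ext^d_R(k, ω)` is one-dimensional over `k`. -/
structure IsCanonicalModule (R : Type u) [CommRing R] [IsLocalRing R]
    (ω : Type u) [AddCommGroup ω] [Module R ω] : Prop where
  maximalCohenMacaulay : IsMaximalCohenMacaulay R ω
  finite_injectiveDimension : ∃ n : ℕ, HasInjectiveDimensionLE (ModuleCat.of R ω) n
  type_one : ∃ d : ℕ, ringKrullDim R = (d : WithBot ℕ∞) ∧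
    Nonempty (Abelian.Ext (ModuleCat.of R (IsLocalRing.ResidueField R)) (ModuleCat.of R ω) d
      ≃ₗ[R] IsLocalRing.ResidueField R)

/-- The trace ideal of a module: the sum of the images of all `R`-linear maps `M → R`. -/
def traceIdeal (R : Type u) [CommRing R] (M : Type u) [AddCommGroup M] [Module R M] : Ideal R :=
  ⨆ f : M →ₗ[R] R, LinearMap.range f

/-- For a subring `S` of `R`, the extension `S ⊆ R` is birational if `Q(S) = Q(R)`, i.e. the
total ring of fractions of `R` is, via the inclusion, also that of `S`, and if `R` is a
finitely generated `S`-module. -/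
def IsBirationalSubring {R : Type u} [CommRing R] (S : Subring R) : Prop :=
  IsFractionRing S (FractionRing R) ∧ Module.Finite S R

/-- The length of `R / S` as an `S`-module, for a subring `S` of `R`. -/
noncomputable def colength {R : Type u} [CommRing R] (S : Subring R) : ℕ∞ :=
  Module.length S (R ⧸ LinearMap.range (Algebra.linearMap S R))

/-- The birational Gorenstein colength `bg(R)`: the infimum of the lengths of the `S`-modules
`R / S` over all Gorenstein subrings `S` of `R` such that `S ⊆ R` is birational. It is `⊤` if
there is no such subring. -/
noncomputable def bg (R : Type u) [CommRing R] : ℕ∞ :=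
  sInf {n : ℕ∞ | ∃ S : Subring R, IsGorensteinRing S ∧ IsBirationalSubring S ∧ n = colength S}

end CanonicalTrace

namespace CanonicalTrace

open Abelian
open scoped Pointwise

/-! Let S ⊆ R be a Gorenstein birational subring with conductor c = S : R. It suffices that c ⊊
tr(ω) and ℓ_S(S/c) ≤ ℓ_S(R/S), since then ℓ_R(R/tr ω) + 1 ≤ ℓ_R(R/c) ≤ ℓ_S(R/c) = ℓ_S(S/c) +
ℓ_S(R/S) ≤ 2 ℓ_S(R/S).

These facts come from duality modulo a regular z ∈ c: S/z is self-injective and ω/zω is injective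
over R/z (`isInjectiveModulo_quotSMulTop`). Every S-linear φ : ω → S is R-linear with values in c,
and these values detect divisibility (`exists_smul_eq`): if b φ(w) ∈ zS for all φ and w, then b ∈
zR. On the side of S, an ideal containing z is an annihilator modulo z (`exists_mul_eq_of_notMem`).

Together they give c ⊆ tr(ω) (`conductorIdeal_le_traceIdeal`), strictness
(`not_traceIdeal_le_conductorIdeal`) and the length bound (`length_quotient_conductor_le`). -/

/-- `E` behaves as an injective module with respect to maps into finitely generated modules
annihilated by `z`. -/
def IsInjectiveModulo {A : Type u} [CommRing A] (z : A) (E : Type u) [AddCommGroup E]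
    [Module A E] : Prop :=
  ∀ (N M : Type u) [AddCommGroup N] [Module A N] [AddCommGroup M] [Module A M]
    [Module.Finite A M], (∀ m : M, z • m = 0) → ∀ (i : N →ₗ[A] M) (f : N →ₗ[A] E),
    LinearMap.ker i ≤ LinearMap.ker f → ∃ g : M →ₗ[A] E, g ∘ₗ i = f

/-! ### Factoring linear maps through surjections and through multiplication by z. -/

section Factor

variable {A : Type*} [CommRing A] {N M P : Type*} [AddCommGroup N] [Module A N]
  [AddCommGroup M] [Module A M] [AddCommGroup P] [Module A P]

theorem exists_comp_eq_of_surjective (p : N →ₗ[A] M) (hp : Function.Surjective p)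
    (f : N →ₗ[A] P) (h : LinearMap.ker p ≤ LinearMap.ker f) : ∃ g : M →ₗ[A] P, g ∘ₗ p = f := by
  refine ⟨(LinearMap.ker p).liftQ f h ∘ₗ (p.quotKerEquivOfSurjective hp).symm.toLinearMap, ?_⟩
  ext x
  have : (p.quotKerEquivOfSurjective hp).symm (p x) = (LinearMap.ker p).mkQ x := by
    rw [LinearEquiv.symm_apply_eq]; rfl
  simp [this]

theorem exists_smul_eq_of_forall_mem {z : A} (hz : IsSMulRegular P z) (f : N →ₗ[A] P)
    (h : ∀ x, ∃ y, z • y = f x) : ∃ g : N →ₗ[A] P, z • g = f := by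
  let l : P →ₗ[A] P := LinearMap.lsmul A P z
  have hl : Function.Injective l := hz
  refine ⟨(LinearEquiv.ofInjective l hl).symm.toLinearMap ∘ₗ f.codRestrict (LinearMap.range l)
    (fun x => h x), ?_⟩
  ext x
  have := LinearEquiv.apply_symm_apply (LinearEquiv.ofInjective l hl)
    (f.codRestrict (LinearMap.range l) (fun x => h x) x)
  exact congrArg Subtype.val this

end Factor

theorem mkQ_smul_top_eq_zero_iff {A : Type*} [CommRing A] {M : Type*} [AddCommGroup M] [Module A M]
    {z : A} {x : M} : (z • (⊤ : Submodule A M)).mkQ x = 0 ↔ ∃ y, z • y = x := by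
  simp [Submodule.mem_smul_pointwise_iff_exists]

theorem smul_quotSMulTop_eq_zero {A : Type*} [CommRing A] {M : Type*} [AddCommGroup M] [Module A M]
    {z : A} (x : QuotSMulTop z M) : z • x = 0 := by
  obtain ⟨x, rfl⟩ := Submodule.mkQ_surjective _ x
  rw [← map_smul]
  exact mkQ_smul_top_eq_zero_iff.2 ⟨x, rfl⟩

/-! ### From finite injective dimension of E to injectivity of E/zE modulo z. -/

section Ext

variable {A : Type u} [CommRing A] {z : A}

theorem shortExact_of_regular {E : Type u} [AddCommGroup E] [Module A E] (hE : IsSMulRegular E z) :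
    (ModuleCat.shortComplexOfCompEqZero (LinearMap.lsmul A E z) (z • (⊤ : Submodule A E)).mkQ
      (by ext x; exact mkQ_smul_top_eq_zero_iff.2 ⟨x, rfl⟩)).ShortExact := by
  refine ModuleCat.shortComplex_shortExact _ ?_ hE (Submodule.mkQ_surjective _)
  intro x
  exact mkQ_smul_top_eq_zero_iff

theorem shortExact_of_submodule {M : Type u} [AddCommGroup M] [Module A M] (N : Submodule A M) :
    (ModuleCat.shortComplexOfCompEqZero N.subtype N.mkQ (by ext; simp)).ShortExact := by
  refine ModuleCat.shortComplex_shortExact _ ?_ N.injective_subtype (Submodule.mkQ_surjective _)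
  exact LinearMap.exact_subtype_mkQ N

theorem nonempty_linearEquiv_of_isSimpleModule [IsLocalRing A] (K L : Type*) [AddCommGroup K]
    [Module A K] [AddCommGroup L] [Module A L] [IsSimpleModule A K] [IsSimpleModule A L] :
    Nonempty (K ≃ₗ[A] L) := by
  obtain ⟨I, hI, ⟨e⟩⟩ := isSimpleModule_iff_quot_maximal.1 ‹IsSimpleModule A K›
  obtain ⟨J, hJ, ⟨e'⟩⟩ := isSimpleModule_iff_quot_maximal.1 ‹IsSimpleModule A L›
  obtain rfl := IsLocalRing.eq_maximalIdeal hI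
  obtain rfl := IsLocalRing.eq_maximalIdeal hJ
  exact ⟨e.trans e'.symm⟩

theorem subsingleton_ext_of_isFiniteLength_of_simple {E : Type u} [AddCommGroup E] [Module A E]
    {k : ℕ} (h : ∀ (K : Type u) [AddCommGroup K] [Module A K] [IsSimpleModule A K],
      Subsingleton (Ext (ModuleCat.of A K) (ModuleCat.of A E) k))
    (M : Type u) [AddCommGroup M] [Module A M] (hM : IsFiniteLength A M) :
    Subsingleton (Ext (ModuleCat.of A M) (ModuleCat.of A E) k) := by
  induction hM with
  | of_subsingleton =>
    rename_i M _ _ _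
    have : Limits.IsZero (ModuleCat.of A M) := ModuleCat.isZero_of_subsingleton _
    refine subsingleton_of_forall_eq 0 fun e => ?_
    rw [← e.mk₀_id_comp, this.eq_zero_of_src (𝟙 _), Ext.mk₀_zero, Ext.zero_comp]
  | of_simple_quotient hN ih =>
    rename_i M _ _ N _
    refine subsingleton_of_forall_eq 0 fun e => ?_
    have := h (M ⧸ N)
    obtain ⟨e', rfl⟩ := Ext.contravariant_sequence_exact₂ (shortExact_of_submodule N) _ e
      (Subsingleton.elim (h := ih) _ _)
    rw [Subsingleton.elim (h := this) e' 0, Ext.comp_zero]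

/-- Over a local ring with a regular element `z` such that `A / z` has finite length, the groups
`Ext^k(M, E)`, `k ≥ 2`, vanish for `M` of finite length and `E` of finite injective dimension. -/
theorem subsingleton_ext_of_isFiniteLength [IsLocalRing A] (hzA : IsSMulRegular A z)
    (hfl : IsFiniteLength A (QuotSMulTop z A)) (hnt : Nontrivial (QuotSMulTop z A))
    {E : Type u} [AddCommGroup E] [Module A E] {n : ℕ}
    (hE : HasInjectiveDimensionLE (ModuleCat.of A E) n) (k : ℕ) (hk : 2 ≤ k)
    (M : Type u) [AddCommGroup M] [Module A M] (hM : IsFiniteLength A M) :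
    Subsingleton (Ext (ModuleCat.of A M) (ModuleCat.of A E) k) := by
  by_cases hkn : n + 1 ≤ k
  · exact HasInjectiveDimensionLT.subsingleton _ _ k hkn _
  obtain ⟨d, hd⟩ : ∃ d, d = n + 1 - k := ⟨_, rfl⟩
  induction d generalizing k M with
  | zero => omega
  | succ d ih =>
    have hsucc : ∀ (M : Type u) [AddCommGroup M] [Module A M], IsFiniteLength A M →
        Subsingleton (Ext (ModuleCat.of A M) (ModuleCat.of A E) (k + 1)) := by
      intro M _ _ hM
      by_cases h : n + 1 ≤ k + 1
      · exact HasInjectiveDimensionLT.subsingleton _ _ (k + 1) h _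
      · exact ih (k + 1) (by omega) M hM h (by omega)
    refine subsingleton_ext_of_isFiniteLength_of_simple (fun K _ _ _ => ?_) M hM
    -- The simple module occurs as a submodule L of A/z. Since Ext^(k+1)((A/z)/L, E) = 0, every
    -- class on L extends to A/z.
    have hart := (isFiniteLength_iff_isNoetherian_isArtinian.1 hfl).2
    obtain ⟨L, hL⟩ := IsAtomic.exists_atom (Submodule A (QuotSMulTop z A))
    have : IsSimpleModule A L := isSimpleModule_iff_isAtom.2 hL
    obtain ⟨e⟩ := nonempty_linearEquiv_of_isSimpleModule (A := A) L K
    let j := e.toModuleIso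
    have hL0 : Subsingleton (Ext (ModuleCat.of A L) (ModuleCat.of A E) k) := by
      refine subsingleton_of_forall_eq 0 fun x => ?_
      have := hsucc _ (hfl.of_surjective (Submodule.mkQ_surjective L))
      obtain ⟨y, rfl⟩ := Ext.contravariant_sequence_exact₁ (shortExact_of_submodule L) _ x
        (add_comm 1 k) (Subsingleton.elim (h := this) _ _)
      have hproj : ∀ m, 1 ≤ m → ∀ w : Ext (ModuleCat.of A A) (ModuleCat.of A E) m, w = 0 := by
        intro m hm w
        obtain ⟨m, rfl⟩ : ∃ m', m = m' + 1 := ⟨m - 1, by omega⟩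
        have : Projective (ModuleCat.of A A) := inferInstance
        exact w.eq_zero_of_projective
      -- Ext^k(A/z, E) lies between Ext^(k-1)(A, E) and Ext^k(A, E), both zero because k ≥ 2.
      obtain ⟨m, rfl⟩ : ∃ m, k = 1 + m := ⟨k - 1, by omega⟩
      obtain ⟨w, hw⟩ := Ext.contravariant_sequence_exact₃ (shortExact_of_regular hzA) _ y
        (hproj _ (by omega) _) rfl
      rw [← hw, show w = 0 from hproj _ (by omega) w]
      simp
    refine subsingleton_of_forall_eq 0 fun x => ?_
    have h1 : x = (Ext.mk₀ j.inv).comp ((Ext.mk₀ j.hom).comp x (zero_add k)) (zero_add k) := by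
      rw [Ext.mk₀_comp_mk₀_assoc, j.inv_hom_id, Ext.mk₀_id_comp]
    rw [h1, Subsingleton.elim (h := hL0) ((Ext.mk₀ j.hom).comp x (zero_add k)) 0, Ext.comp_zero]

theorem isFiniteLength_of_smul_eq_zero (hfl : IsFiniteLength A (QuotSMulTop z A))
    {M : Type u} [AddCommGroup M] [Module A M] [Module.Finite A M] (hM : ∀ m : M, z • m = 0) :
    IsFiniteLength A M := by
  obtain ⟨r, p, hp⟩ := Module.Finite.exists_fin' A M
  obtain ⟨g, hg⟩ := exists_comp_eq_of_surjective (A := A)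
    (LinearMap.compLeft (z • (⊤ : Submodule A A)).mkQ (Fin r))
    (fun y => ⟨fun i => ((Submodule.mkQ_surjective _) (y i)).choose, funext fun i =>
      ((Submodule.mkQ_surjective _) (y i)).choose_spec⟩) p (by
      intro x hx
      have : ∀ i, ∃ y, z • y = x i := fun i =>
        mkQ_smul_top_eq_zero_iff.1 (congrFun (LinearMap.mem_ker.1 hx) i)
      choose y hy using this
      have : x = z • y := by ext i; exact (hy i).symm
      rw [LinearMap.mem_ker, this, map_smul, hM])
  have hgs : Function.Surjective g := fun m => by
    obtain ⟨x, rfl⟩ := hp m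
    exact ⟨_, LinearMap.congr_fun hg x⟩
  obtain ⟨h1, h2⟩ := isFiniteLength_iff_isNoetherian_isArtinian.1 hfl
  exact IsFiniteLength.of_surjective (isFiniteLength_iff_isNoetherian_isArtinian.2
    ⟨inferInstance, inferInstance⟩) hgs

/-- If `z` is regular on `A` and `E`, the ring `A / z` has finite length, and `E` has finite
injective dimension, then `E / z E` is injective as a module over `A / z`. -/
theorem isInjectiveModulo_quotSMulTop [IsLocalRing A] (hzA : IsSMulRegular A z)
    (hfl : IsFiniteLength A (QuotSMulTop z A)) (hnt : Nontrivial (QuotSMulTop z A))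
    {E : Type u} [AddCommGroup E] [Module A E] (hzE : IsSMulRegular E z) {n : ℕ}
    (hE : HasInjectiveDimensionLE (ModuleCat.of A E) n) :
    IsInjectiveModulo z (QuotSMulTop z E) := by
  have key : ∀ (M : Type u) [AddCommGroup M] [Module A M] [Module.Finite A M],
      (∀ m : M, z • m = 0) → ∀ (N : Submodule A M) (f : N →ₗ[A] QuotSMulTop z E),
      ∃ g : M →ₗ[A] QuotSMulTop z E, g ∘ₗ N.subtype = f := by
    intro M _ _ _ hM N f
    have hS := shortExact_of_regular hzE
    have hT := shortExact_of_submodule N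
    let δ := hS.extClass
    -- For M killed by z, δ identifies Hom(M, E/zE) with Ext^1(M, E). The class δf extends from N to
    -- M because Ext^2(M/N, E) = 0, and the extension η comes from some g because zη = 0.
    obtain ⟨η, hη⟩ := Ext.contravariant_sequence_exact₁ hT (ModuleCat.of A E)
      ((Ext.mk₀ (ModuleCat.ofHom f)).comp δ (zero_add 1)) (show 1 + 1 = 2 from rfl)
      (Subsingleton.elim (h := subsingleton_ext_of_isFiniteLength hzA hfl hnt hE 2 le_rfl _
        (isFiniteLength_of_smul_eq_zero hfl (fun m : M ⧸ N => by
          obtain ⟨m, rfl⟩ := Submodule.mkQ_surjective _ m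
          rw [← map_smul, hM, map_zero]))) _ _)
    have hzη : η.comp (Ext.mk₀ (ModuleCat.ofHom (LinearMap.lsmul A E z))) (add_zero 1) = 0 := by
      have h1 : ModuleCat.ofHom (LinearMap.lsmul A E z) = z • 𝟙 (ModuleCat.of A E) := by
        ext; rfl
      have h2 : z • 𝟙 (ModuleCat.of A M) = 0 := by
        ext m; exact hM m
      rw [h1, ← Ext.smul_eq_comp_mk₀]
      have : z • η = (Ext.mk₀ (z • 𝟙 (ModuleCat.of A M))).comp η (zero_add 1) := by
        simp [Ext.mk₀_smul]
      rw [this, h2, Ext.mk₀_zero, Ext.zero_comp]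
    obtain ⟨g, hg⟩ := Ext.covariant_sequence_exact₁ _ hS η hzη (zero_add 1)
    obtain ⟨g, rfl⟩ := Ext.homEquiv₀.symm.surjective g
    have hdiff : (Ext.mk₀ (ModuleCat.ofHom (g.hom ∘ₗ N.subtype - f))).comp δ (zero_add 1) = 0 := by
      have : ModuleCat.ofHom (g.hom ∘ₗ N.subtype - f) =
        ModuleCat.ofHom N.subtype ≫ g - ModuleCat.ofHom f := rfl
      rw [this, sub_eq_add_neg, Ext.mk₀_add, Ext.add_comp, Ext.mk₀_neg, Ext.neg_comp, ← hη, ← hg,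
        ← Ext.mk₀_comp_mk₀, add_neg_eq_zero]
      exact Ext.comp_assoc _ _ _ _ _ (by norm_num)
    obtain ⟨h, hh⟩ := Ext.covariant_sequence_exact₃ _ hS _ (zero_add 1) hdiff
    obtain ⟨h, rfl⟩ := Ext.homEquiv₀.symm.surjective h
    -- Injectivity of δ: N is killed by z while z is regular on E.
    have h0 : h = 0 := by
      ext x
      refine hzE ?_
      change z • h.hom x = z • (0 : E)
      rw [← map_smul, smul_zero, show z • x = 0 from Subtype.ext (hM x), map_zero]
    refine ⟨g.hom, ?_⟩
    rw [← sub_eq_zero]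
    have := hh.symm
    simp only [h0, Ext.homEquiv₀_symm_apply, Ext.mk₀_zero, Ext.zero_comp] at this
    exact congrArg ModuleCat.Hom.hom ((Ext.mk₀_eq_zero_iff _).1 this)
  intro N M _ _ _ _ _ hM i f hif
  obtain ⟨f', hf'⟩ := exists_comp_eq_of_surjective i.rangeRestrict i.surjective_rangeRestrict f
    (by rwa [LinearMap.ker_rangeRestrict])
  obtain ⟨g, hg⟩ := key M hM (LinearMap.range i) f'
  exact ⟨g, by rw [← hf', ← hg]; rfl⟩

end Ext

/-! ### Separating elements by maps into an injective module with nonzero socle. -/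

section Cogenerator

variable {A : Type u} [CommRing A] [IsLocalRing A] {z : A}

/-- The annihilator of v is proper, hence kills the socle element σ, so v ↦ σ defines a map on Av;
injectivity extends it to M. -/
theorem exists_apply_ne_zero {E : Type u} [AddCommGroup E] [Module A E]
    (hE : IsInjectiveModulo z E) (hσ : ∃ σ : E, σ ≠ 0 ∧ ∀ a ∈ IsLocalRing.maximalIdeal A, a • σ = 0)
    {M : Type u} [AddCommGroup M] [Module A M] [Module.Finite A M] (hM : ∀ m : M, z • m = 0)
    {v : M} (hv : v ≠ 0) : ∃ g : M →ₗ[A] E, g v ≠ 0 := by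
  obtain ⟨σ, hσ0, hσ⟩ := hσ
  obtain ⟨g, hg⟩ := hE A M hM (LinearMap.toSpanSingleton A M v) (LinearMap.toSpanSingleton A E σ)
    (by
      intro a ha
      rw [LinearMap.mem_ker, LinearMap.toSpanSingleton_apply] at ha ⊢
      refine hσ a ((IsLocalRing.mem_maximalIdeal a).2 fun hu => hv ?_)
      exact (IsUnit.smul_eq_zero hu).1 ha)
  refine ⟨g, ?_⟩
  have := LinearMap.congr_fun hg 1
  simp only [LinearMap.comp_apply, LinearMap.toSpanSingleton_apply, one_smul] at this
  rwa [this]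

theorem exists_ne_zero_smul_eq_zero {E : Type u} [AddCommGroup E] [Module A E] [Nontrivial E]
    (hfl : IsFiniteLength A E) :
    ∃ σ : E, σ ≠ 0 ∧ ∀ a ∈ IsLocalRing.maximalIdeal A, a • σ = 0 := by
  have hart := (isFiniteLength_iff_isNoetherian_isArtinian.1 hfl).2
  obtain ⟨L, hL⟩ := IsAtomic.exists_atom (Submodule A E)
  have : IsSimpleModule A L := isSimpleModule_iff_isAtom.2 hL
  obtain ⟨J, hJ, ⟨e⟩⟩ := isSimpleModule_iff_quot_maximal.1 this
  obtain rfl := IsLocalRing.eq_maximalIdeal hJ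
  obtain ⟨σ, hσL, hσ⟩ := Submodule.exists_mem_ne_zero_of_ne_bot hL.1
  refine ⟨σ, hσ, fun a ha => ?_⟩
  have : a • (⟨σ, hσL⟩ : L) = 0 := by
    apply e.injective
    rw [map_smul, map_zero]
    obtain ⟨y, hy⟩ := Ideal.Quotient.mk_surjective (e ⟨σ, hσL⟩)
    rw [← hy]
    exact Ideal.Quotient.eq_zero_iff_mem.2 (Ideal.mul_mem_right _ _ ha)
  exact congrArg Subtype.val this

/-- A map A/I → A/z is multiplication by some s with sI ⊆ zA; take one that does not kill the class
of t. -/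
theorem exists_mul_eq_of_notMem (hA : IsInjectiveModulo z (QuotSMulTop z A))
    (hσ : ∃ σ : QuotSMulTop z A, σ ≠ 0 ∧ ∀ a ∈ IsLocalRing.maximalIdeal A, a • σ = 0)
    {I : Ideal A} (hz : z ∈ I) {t : A} (ht : t ∉ I) :
    ∃ s, (∀ x ∈ I, ∃ y, z * y = s * x) ∧ ¬ ∃ y, z * y = s * t := by
  obtain ⟨g, hg⟩ := exists_apply_ne_zero hA hσ (M := A ⧸ I) (v := Ideal.Quotient.mk I t)
    (fun m => by
      obtain ⟨m, rfl⟩ := Ideal.Quotient.mk_surjective m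
      exact Ideal.Quotient.eq_zero_iff_mem.2 (Ideal.mul_mem_right _ _ hz))
    (fun h => ht (Ideal.Quotient.eq_zero_iff_mem.1 h))
  obtain ⟨s, hs⟩ := (z • (⊤ : Submodule A A)).mkQ_surjective (g 1)
  have key : ∀ x, g (Ideal.Quotient.mk I x) = (z • (⊤ : Submodule A A)).mkQ (s * x) := by
    intro x
    have : Ideal.Quotient.mk I x = x • (1 : A ⧸ I) := by
      change _ = Ideal.Quotient.mk I (x * 1)
      rw [mul_one]
    rw [this, map_smul, ← hs, ← map_smul, smul_eq_mul, mul_comm]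
  refine ⟨s, fun x hx => ?_, ?_⟩
  · refine (mkQ_smul_top_eq_zero_iff (A := A) (M := A) (z := z)).1 ?_
    rw [← key, Ideal.Quotient.eq_zero_iff_mem.2 hx, map_zero]
  · rw [key] at hg
    exact fun h => hg (mkQ_smul_top_eq_zero_iff.2 h)

end Cogenerator

/-- Saturation of K makes K/zK embed in F/zF, so g modulo z extends to F/zF and then lifts to F by
projectivity. -/
theorem exists_eq_restrict_add_smul {A : Type u} [CommRing A] {z : A} (hzA : IsSMulRegular A z)
    (hA : IsInjectiveModulo z (QuotSMulTop z A)) {F : Type u} [AddCommGroup F] [Module A F]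
    [Module.Finite A F] [Module.Projective A F] (K : Submodule A F)
    (hK : ∀ y, z • y ∈ K → y ∈ K) (g : K →ₗ[A] A) :
    ∃ (G : F →ₗ[A] A) (g' : K →ₗ[A] A), g = G ∘ₗ K.subtype + z • g' := by
  have hker : LinearMap.ker ((z • (⊤ : Submodule A F)).mkQ ∘ₗ K.subtype) ≤
      LinearMap.ker ((z • (⊤ : Submodule A A)).mkQ ∘ₗ g) := by
    intro k hk
    rw [LinearMap.mem_ker, LinearMap.comp_apply, mkQ_smul_top_eq_zero_iff] at hk ⊢
    obtain ⟨y, hy⟩ := hk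
    have hyK : y ∈ K := hK y (by rw [hy]; exact k.2)
    have hk' : k = z • (⟨y, hyK⟩ : K) := Subtype.ext hy.symm
    exact ⟨g ⟨y, hyK⟩, by rw [hk', LinearMap.map_smul]⟩
  obtain ⟨h, hh⟩ := hA K (QuotSMulTop z F) smul_quotSMulTop_eq_zero
    ((z • (⊤ : Submodule A F)).mkQ ∘ₗ K.subtype) ((z • (⊤ : Submodule A A)).mkQ ∘ₗ g)
    hker
  obtain ⟨G, hG⟩ := Module.projective_lifting_property (z • (⊤ : Submodule A A)).mkQ
    (h ∘ₗ (z • (⊤ : Submodule A F)).mkQ) (Submodule.mkQ_surjective _)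
  obtain ⟨g', hg'⟩ := exists_smul_eq_of_forall_mem hzA (g - G ∘ₗ K.subtype) (fun k => by
    refine mkQ_smul_top_eq_zero_iff.1 ?_
    have h1 := LinearMap.congr_fun hG (k : F)
    have h2 := LinearMap.congr_fun hh k
    rw [LinearMap.sub_apply, map_sub, sub_eq_zero]
    exact (h1.trans h2).symm)
  exact ⟨G, g', by rw [hg']; abel⟩

/-- If `A / z` is injective modulo `z`, then maps from a finitely generated `z`-torsion-free module
to `A / z` lift to `A`. -/
theorem exists_lift_of_isInjectiveModulo {A : Type u} [CommRing A] [IsLocalRing A]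
    [IsNoetherianRing A] {z : A} (hzm : z ∈ IsLocalRing.maximalIdeal A) (hzA : IsSMulRegular A z)
    (hA : IsInjectiveModulo z (QuotSMulTop z A)) {M : Type u} [AddCommGroup M] [Module A M]
    [Module.Finite A M] (hzM : IsSMulRegular M z) (φ : M →ₗ[A] QuotSMulTop z A) :
    ∃ ψ : M →ₗ[A] A, (z • (⊤ : Submodule A A)).mkQ ∘ₗ ψ = φ := by
  obtain ⟨r, p, hp⟩ := Module.Finite.exists_fin' A M
  let K := LinearMap.ker p
  let q : A →ₗ[A] QuotSMulTop z A := (z • (⊤ : Submodule A A)).mkQ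
  have hq : Function.Surjective q := Submodule.mkQ_surjective _
  let ρ : ((Fin r → A) →ₗ[A] A) →ₗ[A] K →ₗ[A] A := LinearMap.lcomp A A K.subtype
  have step : ∀ g : K →ₗ[A] A, ∃ G g', g = ρ G + z • g' := fun g =>
    exists_eq_restrict_add_smul hzA hA K (fun y hy => by
      refine hzM ?_
      change z • p y = z • (0 : M)
      rw [← LinearMap.map_smul, smul_zero]
      exact hy) g
  -- Nakayama: functionals on K extend to the free module. In effect Ext^1(M, A) = 0, the
  -- obstruction to lifting φ.
  have hρ : ⊤ ≤ LinearMap.range ρ := by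
    refine Submodule.le_of_le_smul_of_le_jacobson_bot (I := Ideal.span {z}) Module.Finite.fg_top
      (by
        rw [IsLocalRing.jacobson_eq_maximalIdeal ⊥ bot_ne_top]
        exact (Ideal.span_singleton_le_iff_mem _).2 hzm) ?_
    intro g _
    obtain ⟨G, g', rfl⟩ := step g
    exact Submodule.add_mem_sup ⟨G, rfl⟩
      (Submodule.smul_mem_smul (Ideal.mem_span_singleton_self z) trivial)
  obtain ⟨G, hG⟩ := Module.projective_lifting_property q (φ ∘ₗ p) hq
  -- G lifts φ ∘ p but need not vanish on K; there it equals zg. Subtracting z times an extension of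
  -- g repairs this without changing G modulo z.
  obtain ⟨g, hg⟩ := exists_smul_eq_of_forall_mem hzA (ρ G) (fun k => by
    refine mkQ_smul_top_eq_zero_iff.1 ?_
    have h1 := LinearMap.congr_fun hG k
    simp only [LinearMap.comp_apply, show p k = 0 from k.2, map_zero] at h1
    exact h1)
  obtain ⟨G', hG'⟩ := hρ (trivial : g ∈ ⊤)
  obtain ⟨ψ, hψ⟩ := exists_comp_eq_of_surjective p hp (G - z • G') (fun k hk => by
    have h1 := LinearMap.congr_fun hg ⟨k, hk⟩
    rw [← hG'] at h1
    rw [LinearMap.mem_ker, LinearMap.sub_apply, sub_eq_zero]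
    exact h1.symm)
  refine ⟨ψ, ?_⟩
  ext m
  obtain ⟨x, rfl⟩ := hp m
  have h1 := LinearMap.congr_fun hψ x
  have h2 := LinearMap.congr_fun hG x
  simp only [LinearMap.comp_apply, LinearMap.sub_apply, LinearMap.smul_apply] at h1 h2 ⊢
  rw [h1, map_sub, map_smul, smul_quotSMulTop_eq_zero, sub_zero]
  exact h2

/-! ### The conductor, and duality between S and R modulo its regular elements. -/

/-- The largest ideal of `R` contained in the image of `S`. -/
def conductorIdeal (S R : Type*) [CommRing S] [CommRing R] [Algebra S R] : Ideal R where
  carrier := {t | ∀ r : R, ∃ s : S, algebraMap S R s = t * r}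
  add_mem' := by
    intro a b ha hb r
    obtain ⟨s, hs⟩ := ha r
    obtain ⟨t, ht⟩ := hb r
    exact ⟨s + t, by rw [map_add, hs, ht, add_mul]⟩
  zero_mem' := fun r => ⟨0, by simp⟩
  smul_mem' := by
    intro c a ha r
    obtain ⟨s, hs⟩ := ha (c * r)
    exact ⟨s, by rw [hs, smul_eq_mul]; ring⟩

theorem mem_conductorIdeal {S R : Type*} [CommRing S] [CommRing R] [Algebra S R] {t : R} :
    t ∈ conductorIdeal S R ↔ ∀ r : R, ∃ s : S, algebraMap S R s = t * r := Iff.rfl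

/-- A regular element `z` of the conductor of `S ⊆ R` lying in the maximal ideal of `S`, such that
`S / z` and `ω / z ω` are injective modulo `z` and have nonzero socles. -/
structure IsDualizingElement (S R ω : Type u) [CommRing S] [IsLocalRing S] [CommRing R]
    [IsLocalRing R] [Algebra S R] [AddCommGroup ω] [Module R ω] (z : S) : Prop where
  mem_maximalIdeal : z ∈ IsLocalRing.maximalIdeal S
  regular : IsSMulRegular R (algebraMap S R z)
  regular_module : IsSMulRegular ω (algebraMap S R z)
  mem_conductor : algebraMap S R z ∈ conductorIdeal S R
  injective_base : IsInjectiveModulo z (QuotSMulTop z S)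
  injective_module : IsInjectiveModulo (algebraMap S R z) (QuotSMulTop (algebraMap S R z) ω)
  socle_base : ∃ σ : QuotSMulTop z S, σ ≠ 0 ∧ ∀ a ∈ IsLocalRing.maximalIdeal S, a • σ = 0
  socle_module : ∃ σ : QuotSMulTop (algebraMap S R z) ω,
    σ ≠ 0 ∧ ∀ a ∈ IsLocalRing.maximalIdeal R, a • σ = 0
  socle_ring : ∃ σ : QuotSMulTop (algebraMap S R z) R,
    σ ≠ 0 ∧ ∀ a ∈ IsLocalRing.maximalIdeal R, a • σ = 0

section Duality

variable {S R ω : Type u} [CommRing S] [IsLocalRing S] [CommRing R] [IsLocalRing R] [Algebra S R]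
  [AddCommGroup ω] [Module R ω] [Module S ω] [IsScalarTower S R ω] {z : S}

namespace IsDualizingElement

/-- Since zr = s lies in S, zφ(rw) = φ(sw) = sφ(w) = zrφ(w); cancel z. -/
theorem algebraMap_apply_smul (hz : IsDualizingElement S R ω z) (φ : ω →ₗ[S] S) (r : R) (w : ω) :
    algebraMap S R (φ (r • w)) = r * algebraMap S R (φ w) := by
  obtain ⟨s, hs⟩ := hz.mem_conductor r
  refine hz.regular ?_
  change algebraMap S R z * _ = algebraMap S R z * _
  rw [← map_mul, ← smul_eq_mul z, ← φ.map_smul, ← algebraMap_smul R z (r • w), smul_smul, ← hs,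
    algebraMap_smul, φ.map_smul, smul_eq_mul, map_mul, hs, mul_assoc]

/-- The `R`-linear map underlying an `S`-linear functional. -/
def functional (hz : IsDualizingElement S R ω z) (φ : ω →ₗ[S] S) : ω →ₗ[R] R where
  toFun w := algebraMap S R (φ w)
  map_add' := by simp
  map_smul' r w := hz.algebraMap_apply_smul φ r w

theorem functional_mem_conductorIdeal (hz : IsDualizingElement S R ω z) (φ : ω →ₗ[S] S) (w : ω) :
    algebraMap S R (φ w) ∈ conductorIdeal S R := fun r =>
  ⟨φ (r • w), by rw [hz.algebraMap_apply_smul, mul_comm]⟩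

variable [IsNoetherianRing S] [Module.Finite S R] [Module.Finite R ω]

/-- If b ∉ zR, a map R/z → ω/zω gives w with bw ∉ zω. An S-map ω/zω → S/z detects bw and lifts to φ
: ω → S, so bφ(w) = φ(bw) ∉ zS. -/
theorem exists_smul_eq (hinj : Function.Injective (algebraMap S R))
    (hz : IsDualizingElement S R ω z) {b : R}
    (h : ∀ (φ : ω →ₗ[S] S) (w : ω), ∃ s : S, algebraMap S R (z * s) = b * algebraMap S R (φ w)) :
    ∃ r, algebraMap S R z * r = b := by
  by_contra hb
  have : Module.Finite S ω := Module.Finite.trans R ω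
  have hzS : IsSMulRegular S z := fun x y hxy => hinj (hz.regular (by
    have := congrArg (algebraMap S R) hxy
    simpa [smul_eq_mul] using this))
  obtain ⟨g, hg⟩ := exists_apply_ne_zero hz.injective_module hz.socle_module
    (M := QuotSMulTop (algebraMap S R z) R) smul_quotSMulTop_eq_zero
    (v := (algebraMap S R z • (⊤ : Submodule R R)).mkQ b)
    (fun h => hb (mkQ_smul_top_eq_zero_iff.1 h))
  obtain ⟨w, hw⟩ := (algebraMap S R z • (⊤ : Submodule R ω)).mkQ_surjective
    (g ((algebraMap S R z • (⊤ : Submodule R R)).mkQ 1))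
  have hgb : g ((algebraMap S R z • (⊤ : Submodule R R)).mkQ b) =
      (algebraMap S R z • (⊤ : Submodule R ω)).mkQ (b • w) := by
    rw [LinearMap.map_smul, hw, ← g.map_smul, ← LinearMap.map_smul, smul_eq_mul, mul_one]
  rw [hgb] at hg
  have hbw : (z • (⊤ : Submodule S ω)).mkQ (b • w) ≠ 0 := by
    intro h0
    obtain ⟨y, hy⟩ := mkQ_smul_top_eq_zero_iff.1 h0
    exact hg (mkQ_smul_top_eq_zero_iff.2 ⟨y, by rw [algebraMap_smul, hy]⟩)
  obtain ⟨φ', hφ'⟩ := exists_apply_ne_zero hz.injective_base hz.socle_base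
    (M := QuotSMulTop z ω) smul_quotSMulTop_eq_zero hbw
  obtain ⟨φ, hφ⟩ := exists_lift_of_isInjectiveModulo hz.mem_maximalIdeal hzS hz.injective_base
    (M := ω) (fun x y hxy => hz.regular_module (by simpa [algebraMap_smul] using hxy))
    (φ' ∘ₗ (z • (⊤ : Submodule S ω)).mkQ)
  obtain ⟨s, hs⟩ := h φ w
  rw [← hz.algebraMap_apply_smul] at hs
  refine hφ' ?_
  have := LinearMap.congr_fun hφ (b • w)
  rw [LinearMap.comp_apply, LinearMap.comp_apply] at this
  rw [← this]
  exact mkQ_smul_top_eq_zero_iff.2 ⟨s, hinj hs⟩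

/-- In fact c is the ideal T generated by the values of S-functionals on ω. By Nakayama it is enough
that c ⊆ T + zc. -/
theorem conductorIdeal_le_traceIdeal [IsNoetherianRing R]
    (hinj : Function.Injective (algebraMap S R))
    (hz : IsDualizingElement S R ω z) (hz2 : IsDualizingElement S R ω (z * z)) :
    conductorIdeal S R ≤ traceIdeal R ω := by
  let T : Ideal R := Ideal.span {t | ∃ (φ : ω →ₗ[S] S) (w : ω), algebraMap S R (φ w) = t}
  have hT : T ≤ traceIdeal R ω := by
    refine Ideal.span_le.2 ?_
    rintro _ ⟨φ, w, rfl⟩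
    exact (le_iSup (fun f : ω →ₗ[R] R => LinearMap.range f) (hz.functional φ)) ⟨w, rfl⟩
  have hTc : T ≤ conductorIdeal S R := by
    refine Ideal.span_le.2 ?_
    rintro _ ⟨φ, w, rfl⟩
    exact hz.functional_mem_conductorIdeal φ w
  refine le_trans ?_ hT
  have hzm : algebraMap S R z ∈ IsLocalRing.maximalIdeal R := by
    refine (IsLocalRing.mem_maximalIdeal _).2 fun hu => ?_
    obtain ⟨r, hr⟩ := hu.exists_right_inv
    -- If zr = 1 in R, then z²r³ lies in S and is inverse to z, contrary to z being in the maximal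
    -- ideal of S.
    obtain ⟨s, hs⟩ := hz2.mem_conductor (r * r * r)
    have : z * s = 1 := hinj (by
      rw [map_mul, hs, map_mul, map_one]
      calc _ = (algebraMap S R z * r) ^ 3 := by ring
        _ = 1 := by rw [hr, one_pow])
    exact (IsLocalRing.mem_maximalIdeal z).1 hz.mem_maximalIdeal (IsUnit.of_mul_eq_one _ this)
  refine Submodule.le_of_le_smul_of_le_jacobson_bot (I := Ideal.span {algebraMap S R z})
    (IsNoetherian.noetherian _) (by
      rw [IsLocalRing.jacobson_eq_maximalIdeal ⊥ bot_ne_top]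
      exact (Ideal.span_singleton_le_iff_mem _).2 hzm) ?_
  intro t ht
  by_contra htJ
  let J : Ideal R := T ⊔ Ideal.span {algebraMap S R z} • conductorIdeal S R
  -- The modulus is z² because it must lie in T + zc, and z ∈ c gives z² ∈ zc.
  obtain ⟨t', ht'⟩ := ht 1
  rw [mul_one] at ht'
  obtain ⟨s, hs, hst⟩ := exists_mul_eq_of_notMem hz2.injective_base hz2.socle_base
    (I := J.comap (algebraMap S R)) (t := t') (by
      rw [Ideal.mem_comap, map_mul]
      exact Submodule.mem_sup_right
        (Submodule.smul_mem_smul (Ideal.mem_span_singleton_self _) hz.mem_conductor))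
    (by rw [Ideal.mem_comap, ht']; exact htJ)
  obtain ⟨r, hr⟩ := hz2.exists_smul_eq hinj (b := algebraMap S R s) (fun φ w => by
    obtain ⟨y, hy⟩ := hs (φ w) (by
      rw [Ideal.mem_comap]
      exact Submodule.mem_sup_left (Ideal.subset_span ⟨φ, w, rfl⟩))
    exact ⟨y, by rw [hy, map_mul]⟩)
  obtain ⟨y, hy⟩ := ht r
  refine hst ⟨y, hinj ?_⟩
  rw [map_mul (algebraMap S R) (z * z), hy, map_mul (algebraMap S R) s, ht', ← hr]
  ring

/-- Let b represent a socle element of R/zR. As φ takes values in c, inside the maximal ideal, bφ =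
zf for some f : ω → R. If all such f had values in c ⊆ S, then bφ(w) ∈ zS throughout and b ∈ zR. -/
theorem not_traceIdeal_le_conductorIdeal (hinj : Function.Injective (algebraMap S R))
    (hsurj : ¬ Function.Surjective (algebraMap S R)) (hz : IsDualizingElement S R ω z) :
    ¬ traceIdeal R ω ≤ conductorIdeal S R := by
  intro hle
  have hne : conductorIdeal S R ≠ ⊤ := fun h => hsurj fun r => by
    obtain ⟨s, hs⟩ := (Ideal.eq_top_iff_one _).1 h r
    exact ⟨s, by rw [hs, one_mul]⟩
  obtain ⟨σ, hσ0, hσ⟩ := hz.socle_ring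
  obtain ⟨b, rfl⟩ := (algebraMap S R z • (⊤ : Submodule R R)).mkQ_surjective σ
  refine hσ0 (mkQ_smul_top_eq_zero_iff.2 ?_)
  refine hz.exists_smul_eq hinj fun φ w => ?_
  obtain ⟨f, hf⟩ := exists_smul_eq_of_forall_mem hz.regular (b • hz.functional φ) (fun w => by
    have := hσ _ (IsLocalRing.le_maximalIdeal hne (hz.functional_mem_conductorIdeal φ w))
    rw [← LinearMap.map_smul, mkQ_smul_top_eq_zero_iff] at this
    obtain ⟨y, hy⟩ := this
    exact ⟨y, by rw [hy, LinearMap.smul_apply, smul_eq_mul, smul_eq_mul, mul_comm]; rfl⟩)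
  have hfw : f w ∈ traceIdeal R ω :=
    (le_iSup (fun f : ω →ₗ[R] R => LinearMap.range f) f) ⟨w, rfl⟩
  obtain ⟨s, hs⟩ := hle hfw 1
  refine ⟨s, ?_⟩
  rw [map_mul, hs, mul_one]
  exact LinearMap.congr_fun hf w

/-- The map I ↦ S :_R I from ideals of S containing c to S-modules between S and R is strictly
order-reversing, so chains in S/c give chains in R/S. -/
theorem length_quotient_conductor_le (hinj : Function.Injective (algebraMap S R))
    (hz : IsDualizingElement S R ω z) :
    Module.length S (S ⧸ (conductorIdeal S R).comap (algebraMap S R)) ≤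
      Module.length S (R ⧸ LinearMap.range (Algebra.linearMap S R)) := by
  let c : Ideal S := (conductorIdeal S R).comap (algebraMap S R)
  let C : Submodule S (S ⧸ c) → Submodule S R := fun P =>
    { carrier := {r | ∀ x : S, c.mkQ x ∈ P → ∃ s : S, algebraMap S R s = algebraMap S R x * r}
      add_mem' := by
        intro a b ha hb x hx
        obtain ⟨s, hs⟩ := ha x hx
        obtain ⟨t, ht⟩ := hb x hx
        exact ⟨s + t, by rw [map_add, hs, ht, mul_add]⟩
      zero_mem' := fun x _ => ⟨0, by simp⟩
      smul_mem' := by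
        intro a r hr x hx
        obtain ⟨s, hs⟩ := hr x hx
        exact ⟨a * s, by rw [map_mul, hs, Algebra.smul_def]; ring⟩ }
  have hC : ∀ P, LinearMap.range (Algebra.linearMap S R) ≤ C P := by
    rintro P _ ⟨s, rfl⟩ x _
    exact ⟨x * s, by rw [map_mul]; rfl⟩
  have hanti : StrictMono fun P => OrderDual.toDual
      ((C P).map (LinearMap.range (Algebra.linearMap S R)).mkQ) := by
    intro P P' hPP'
    have hle : C P' ≤ C P := fun r hr x hx => hr x (hPP'.le hx)
    refine lt_of_le_not_ge (Submodule.map_mono hle) fun hge => ?_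
    have hge' : C P ≤ C P' := by
      intro r hr
      obtain ⟨r', hr', h⟩ := hge (Submodule.mem_map_of_mem hr)
      rw [Submodule.mkQ_apply, Submodule.mkQ_apply, Submodule.Quotient.eq] at h
      have := (C P').sub_mem hr' (hC P' h)
      rwa [sub_sub_cancel] at this
    obtain ⟨τ, hτ', hτ⟩ := SetLike.exists_of_lt hPP'
    obtain ⟨t, rfl⟩ := c.mkQ_surjective τ
    have hcP : ∀ x ∈ c, x ∈ P.comap c.mkQ := fun x hx => by
      rw [Submodule.mem_comap, (Submodule.mkQ_apply c x).trans
        ((Submodule.Quotient.mk_eq_zero c).2 hx)]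
      exact P.zero_mem
    -- With sI ⊆ zS and st ∉ zS, the quotient r = s/z exists in R, lies in S : I, and satisfies rt ∉
    -- S.
    obtain ⟨s, hs, hst⟩ := exists_mul_eq_of_notMem hz.injective_base hz.socle_base
      (I := P.comap c.mkQ) (hcP z hz.mem_conductor) (t := t) hτ
    obtain ⟨r, hr⟩ := hz.exists_smul_eq hinj (b := algebraMap S R s) (fun φ w => by
      obtain ⟨y, hy⟩ := hs (φ w) (hcP _ (hz.functional_mem_conductorIdeal φ w))
      exact ⟨y, by rw [hy, map_mul]⟩)
    have hrP : r ∈ C P := by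
      intro x hx
      obtain ⟨y, hy⟩ := hs x hx
      refine ⟨y, hz.regular ?_⟩
      change algebraMap S R z * _ = algebraMap S R z * _
      rw [← map_mul, hy, map_mul, ← hr]
      ring
    obtain ⟨y, hy⟩ := hge' hrP t hτ'
    refine hst ⟨y, hinj ?_⟩
    rw [map_mul, map_mul, hy, ← hr]
    ring
  rw [← WithBot.coe_le_coe, Module.coe_length, Module.coe_length]
  exact (Order.krullDim_le_of_strictMono _ hanti).trans (Order.krullDim_orderDual).le

theorem length_quotient_traceIdeal_add_one_le [IsNoetherianRing R]
    (hinj : Function.Injective (algebraMap S R))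
    (hsurj : ¬ Function.Surjective (algebraMap S R))
    (hz : IsDualizingElement S R ω z) (hz2 : IsDualizingElement S R ω (z * z)) :
    Module.length R (R ⧸ traceIdeal R ω) + 1 ≤
      2 * Module.length S (R ⧸ LinearMap.range (Algebra.linearMap S R)) := by
  let c := conductorIdeal S R
  have hle : c ≤ traceIdeal R ω := hz.conductorIdeal_le_traceIdeal hinj hz2
  have h1 : Module.length R (R ⧸ traceIdeal R ω) + 1 ≤ Module.length R (R ⧸ c) := by
    let f : (R ⧸ c) →ₗ[R] R ⧸ traceIdeal R ω := Submodule.factor hle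
    rw [Module.length_eq_add_of_exact (LinearMap.ker f).subtype f
      (LinearMap.ker f).injective_subtype (Submodule.factor_surjective hle)
      (LinearMap.exact_subtype_ker_map f), add_comm]
    refine add_le_add_left (Order.one_le_iff_pos.2 (Module.length_pos_iff.2 ?_)) _
    obtain ⟨t, ht, htc⟩ := SetLike.not_le_iff_exists.1
      (hz.not_traceIdeal_le_conductorIdeal hinj hsurj)
    refine nontrivial_of_ne (⟨c.mkQ t, ?_⟩ : LinearMap.ker f) 0 fun h => htc ?_
    · exact (Submodule.Quotient.mk_eq_zero _).2 ht
    · exact (Submodule.Quotient.mk_eq_zero c).1 (congrArg Subtype.val h)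
  -- Every R-submodule is an S-submodule, so no comparison of residue fields is needed.
  have h2 : Module.length R (R ⧸ c) ≤ Module.length S (R ⧸ c) := by
    rw [← WithBot.coe_le_coe, Module.coe_length, Module.coe_length]
    exact Order.krullDim_le_of_orderEmbedding (Submodule.restrictScalarsEmbedding S R (R ⧸ c))
  have h3 : Module.length S (R ⧸ c) = Module.length S (S ⧸ c.comap (algebraMap S R)) +
      Module.length S (R ⧸ LinearMap.range (Algebra.linearMap S R)) := by
    have hmk : Function.Surjective (c.mkQ.restrictScalars S) := c.mkQ_surjective
    obtain ⟨f, hf⟩ := exists_comp_eq_of_surjective (Submodule.mkQ (c.comap (algebraMap S R)))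
      (Submodule.mkQ_surjective _) (c.mkQ.restrictScalars S ∘ₗ Algebra.linearMap S R) (by
        intro x hx
        rw [Submodule.ker_mkQ] at hx
        exact (Submodule.Quotient.mk_eq_zero c).2 hx)
    obtain ⟨g, hg⟩ := exists_comp_eq_of_surjective (c.mkQ.restrictScalars S) hmk
      (LinearMap.range (Algebra.linearMap S R)).mkQ (by
        intro x hx
        obtain ⟨s, hs⟩ := (Submodule.Quotient.mk_eq_zero c).1 hx 1
        rw [Submodule.ker_mkQ]
        exact ⟨s, hs.trans (mul_one x)⟩)
    have hf' := LinearMap.congr_fun hf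
    have hg' := LinearMap.congr_fun hg
    refine Module.length_eq_add_of_exact f g ?_ ?_ ?_
    · refine (injective_iff_map_eq_zero f).2 fun x hx => ?_
      obtain ⟨x, rfl⟩ := Submodule.mkQ_surjective _ x
      have := (hf' x).symm.trans hx
      exact (Submodule.Quotient.mk_eq_zero _).2
        (show algebraMap S R x ∈ c from (Submodule.Quotient.mk_eq_zero c).1 this)
    · intro y
      obtain ⟨r, rfl⟩ := Submodule.mkQ_surjective _ y
      exact ⟨_, hg' r⟩
    · intro y
      obtain ⟨r, rfl⟩ := hmk y
      constructor
      · intro h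
        obtain ⟨s, rfl⟩ := (Submodule.Quotient.mk_eq_zero _).1 ((hg' r).symm.trans h)
        exact ⟨_, hf' s⟩
      · rintro ⟨x, hx⟩
        obtain ⟨x, rfl⟩ := Submodule.mkQ_surjective _ x
        rw [← hx]
        have h1 : f (Submodule.mkQ _ x) = c.mkQ.restrictScalars S (algebraMap S R x) := hf' x
        rw [h1]
        exact (hg' _).trans ((Submodule.Quotient.mk_eq_zero _).2 ⟨x, rfl⟩)
  calc _ ≤ Module.length R (R ⧸ c) := h1
    _ ≤ Module.length S (R ⧸ c) := h2
    _ = _ := h3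
    _ ≤ _ := by rw [two_mul]; exact add_le_add_left (hz.length_quotient_conductor_le hinj) _

end IsDualizingElement

end Duality

/-! ### Invariance of the Gorenstein property, and its meaning for local rings. -/

section Transport

attribute [local instance] RingHomInvPair.of_ringEquiv

theorem hasInjectiveDimensionLE_self_of_ringEquiv {A B : Type u} [CommRing A] [CommRing B]
    (e : A ≃+* B) {n : ℕ} (h : HasInjectiveDimensionLE (ModuleCat.of A A) n) :
    HasInjectiveDimensionLE (ModuleCat.of B B) n :=
  (ModuleCat.hasInjectiveDimensionLE_iff_of_semiLinearEquiv e
    (M := ModuleCat.of A A) (N := ModuleCat.of B B)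
    { e with map_smul' := fun a b => e.map_mul a b } n).1 h

theorem IsGorensteinRing.of_ringEquiv {A B : Type u} [CommRing A] [CommRing B] (e : A ≃+* B)
    (h : IsGorensteinRing A) : IsGorensteinRing B := by
  have := h.1
  refine ⟨isNoetherianRing_of_ringEquiv A e, fun p _ => ?_⟩
  obtain ⟨n, hn⟩ := h.2 (p.comap e.toRingHom)
  refine ⟨n, hasInjectiveDimensionLE_self_of_ringEquiv
    (IsLocalization.ringEquivOfRingEquiv (M := (p.comap e.toRingHom).primeCompl)
      (T := p.primeCompl) (Localization.AtPrime (p.comap e.toRingHom))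
      (Localization.AtPrime p) e ?_) hn⟩
  ext b
  constructor
  · rintro ⟨a, ha, rfl⟩
    exact ha
  · intro hb
    refine ⟨e.symm b, fun hmem => hb ?_, e.apply_symm_apply b⟩
    have : e (e.symm b) ∈ p := hmem
    rwa [e.apply_symm_apply] at this

theorem IsGorensteinRing.exists_hasInjectiveDimensionLE {A : Type u} [CommRing A] [IsLocalRing A]
    (h : IsGorensteinRing A) : ∃ n : ℕ, HasInjectiveDimensionLE (ModuleCat.of A A) n := by
  obtain ⟨n, hn⟩ := h.2 (IsLocalRing.maximalIdeal A)
  refine ⟨n, hasInjectiveDimensionLE_self_of_ringEquiv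
    (IsLocalization.atUnits A (IsLocalRing.maximalIdeal A).primeCompl
      (S := Localization.AtPrime (IsLocalRing.maximalIdeal A)) ?_).symm.toRingEquiv hn⟩
  intro a ha
  by_contra h
  exact ha ((IsLocalRing.mem_maximalIdeal a).2 h)

end Transport

/-! ### Dimension one and integrality: finite length modulo z, and locality of S. -/

section Dimension

theorem isFiniteLength_quotSMulTop {A : Type u} [CommRing A] [IsNoetherianRing A] {z : A}
    (h : ∀ p : Ideal A, p.IsPrime → z ∈ p → p.IsMaximal) : IsFiniteLength A (QuotSMulTop z A) := by
  have hI : z • (⊤ : Submodule A A) = Ideal.span {z} := by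
    rw [← Submodule.ideal_span_singleton_smul, smul_eq_mul, Ideal.mul_top]
  change IsFiniteLength A (A ⧸ z • (⊤ : Submodule A A))
  rw [hI]
  have : Ring.KrullDimLE 0 (A ⧸ Ideal.span {z}) := Ring.krullDimLE_zero_iff.2 fun J hJ => by
    have hmax := h (J.comap (Ideal.Quotient.mk (Ideal.span {z}))) inferInstance (by
      rw [Ideal.mem_comap, Ideal.Quotient.eq_zero_iff_mem.2 (Ideal.mem_span_singleton_self z)]
      exact J.zero_mem)
    exact Ideal.isMaximal_of_isIntegral_of_isMaximal_comap (R := A) J hmax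
  have hart : IsArtinianRing (A ⧸ Ideal.span {z}) :=
    isArtinianRing_iff_isNoetherianRing_krullDimLE_zero.2 ⟨inferInstance, this⟩
  have : IsArtinian A (A ⧸ Ideal.span {z}) :=
    isArtinian_of_surjective_algebraMap (R := A ⧸ Ideal.span {z})
      (Ideal.Quotient.mk_surjective (I := Ideal.span {z}))
  exact isFiniteLength_iff_isNoetherian_isArtinian.2 ⟨inferInstance, this⟩

theorem isMaximal_of_mem_of_ringKrullDim_le_one {A : Type u} [CommRing A]
    (hA : ringKrullDim A ≤ 1) {z : A} (hz : IsSMulRegular A z) (p : Ideal A) (hp : p.IsPrime)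
    (hzp : z ∈ p) : p.IsMaximal := by
  have h1 := ringKrullDim_quotient_succ_le_of_nonZeroDivisor (r := z)
    (mem_nonZeroDivisors_iff_right.2 fun x hx => hz (by
      simpa [smul_eq_mul, mul_comm] using hx))
  have h2 : ringKrullDim (A ⧸ Ideal.span {z}) ≤ 0 := by
    have h3 := h1.trans hA
    have h4 : ringKrullDim (A ⧸ Ideal.span {z}) + 1 ≤ 0 + 1 := by rwa [zero_add]
    exact (WithBot.add_le_add_iff_right' (c := (1 : WithBot ℕ∞)) WithBot.one_ne_bot
      (fun h => ENat.one_ne_top (WithBot.coe_injective h))).1 h4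
  have h5 : Ring.KrullDimLE 0 (A ⧸ Ideal.span {z}) := Ring.krullDimLE_iff.2 (by exact_mod_cast h2)
  have hker : RingHom.ker (Ideal.Quotient.mk (Ideal.span {z})) ≤ p := by
    rwa [Ideal.mk_ker, Ideal.span_singleton_le_iff_mem]
  have hprime : (p.map (Ideal.Quotient.mk (Ideal.span {z}))).IsPrime :=
    Ideal.map_isPrime_of_surjective Ideal.Quotient.mk_surjective hker
  have := Ring.krullDimLE_zero_iff.1 h5 _ hprime
  have hcomap := Ideal.comap_map_of_surjective' (Ideal.Quotient.mk (Ideal.span {z}))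
    Ideal.Quotient.mk_surjective p
  rw [sup_eq_left.2 hker] at hcomap
  rw [← hcomap]
  exact Ideal.comap_isMaximal_of_surjective _ Ideal.Quotient.mk_surjective

theorem isMaximal_of_isIntegral {S R : Type u} [CommRing S] [CommRing R] [Algebra S R]
    [Algebra.IsIntegral S R] (hinj : Function.Injective (algebraMap S R)) {z : S}
    (h : ∀ p : Ideal R, p.IsPrime → algebraMap S R z ∈ p → p.IsMaximal) (p : Ideal S)
    (hp : p.IsPrime) (hzp : z ∈ p) : p.IsMaximal := by
  obtain ⟨Q, -, hQ, rfl⟩ := Ideal.exists_ideal_over_prime_of_isIntegral (S := R) p ⊥ (by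
    intro x hx
    have : x = 0 := hinj (by rw [map_zero]; exact hx)
    rw [this]
    exact p.zero_mem)
  have := h Q hQ hzp
  exact Ideal.isMaximal_comap_of_isIntegral_of_isMaximal Q

/-- By lying over, every maximal ideal of S is contracted from R, hence from its only maximal ideal.
-/
theorem isLocalRing_of_isIntegral {S R : Type u} [CommRing S] [CommRing R] [Algebra S R]
    [IsLocalRing R] [Algebra.IsIntegral S R] (hinj : Function.Injective (algebraMap S R)) :
    IsLocalRing S := by
  refine IsLocalRing.of_unique_max_ideal
    ⟨(IsLocalRing.maximalIdeal R).comap (algebraMap S R),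
      Ideal.isMaximal_comap_of_isIntegral_of_isMaximal _, fun p hp => ?_⟩
  obtain ⟨Q, -, hQ, rfl⟩ := Ideal.exists_ideal_over_prime_of_isIntegral (S := R) p ⊥ (by
    intro x hx
    have : x = 0 := hinj (by rw [map_zero]; exact hx)
    rw [this]
    exact p.zero_mem)
  refine (hp.eq_of_le (Ideal.IsPrime.comap _).ne_top
    (Ideal.comap_mono (IsLocalRing.le_maximalIdeal hQ.ne_top))).trans rfl

/-- In a local ring of dimension at most one, an `M`-regular element of the maximal ideal can be
replaced by any regular element of the ring. -/
theorem isSMulRegular_of_isSMulRegular {R : Type u} [CommRing R] [IsLocalRing R] {z r : R}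
    (h : ∀ p : Ideal R, p.IsPrime → z ∈ p → p.IsMaximal) (hr : r ∈ IsLocalRing.maximalIdeal R)
    {M : Type u} [AddCommGroup M] [Module R M] (hM : IsSMulRegular M r) : IsSMulRegular M z := by
  -- A power of r is a multiple of z, and a factor of an M-regular element is M-regular.
  have hrad : r ∈ (Ideal.span {z}).radical := by
    rw [Ideal.radical_eq_sInf]
    refine Submodule.mem_sInf.2 ?_
    rintro p ⟨hzp, hp⟩
    rw [IsLocalRing.eq_maximalIdeal (h p hp ((Ideal.span_singleton_le_iff_mem p).1 hzp))]
    exact hr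
  obtain ⟨k, hk⟩ := hrad
  obtain ⟨s, hs⟩ := Ideal.mem_span_singleton'.1 hk
  refine IsSMulRegular.of_mul (a := s) ?_
  rw [hs]
  exact hM.pow k

end Dimension

/-! ### Producing dualizing elements and assembling the inequality. -/

section Main

variable {S R ω : Type u} [CommRing S] [IsLocalRing S] [IsNoetherianRing S] [CommRing R]
  [IsLocalRing R] [IsNoetherianRing R] [Algebra S R] [Module.Finite S R]
  [AddCommGroup ω] [Module R ω] [Module.Finite R ω] [Nontrivial ω]

theorem isDualizingElement (hinj : Function.Injective (algebraMap S R)) (hdim : ringKrullDim R ≤ 1)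
    {n m : ℕ} (hS : HasInjectiveDimensionLE (ModuleCat.of S S) n)
    (hω : HasInjectiveDimensionLE (ModuleCat.of R ω) m) {r : R}
    (hr : r ∈ IsLocalRing.maximalIdeal R) (hrω : IsSMulRegular ω r) {z : S}
    (hzm : z ∈ IsLocalRing.maximalIdeal S) (hz : IsSMulRegular R (algebraMap S R z))
    (hzc : algebraMap S R z ∈ conductorIdeal S R) : IsDualizingElement S R ω z := by
  have hprime := isMaximal_of_mem_of_ringKrullDim_le_one hdim hz
  have hzS : IsSMulRegular S z := fun x y hxy => hinj (hz (by
    have := congrArg (algebraMap S R) hxy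
    simpa [smul_eq_mul] using this))
  have hzω := isSMulRegular_of_isSMulRegular hprime hr hrω
  have hflR := isFiniteLength_quotSMulTop hprime
  have hflS := isFiniteLength_quotSMulTop (isMaximal_of_isIntegral hinj hprime)
  have hzmR : algebraMap S R z ∈ IsLocalRing.maximalIdeal R := by
    have := Ideal.isMaximal_comap_of_isIntegral_of_isMaximal (R := S) (IsLocalRing.maximalIdeal R)
    rw [← IsLocalRing.eq_maximalIdeal this] at hzm
    exact hzm
  have hntS := nontrivial_quotSMulTop_of_mem_maximalIdeal S hzm
  have hntR := nontrivial_quotSMulTop_of_mem_maximalIdeal R hzmR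
  have hntω := nontrivial_quotSMulTop_of_mem_maximalIdeal ω hzmR
  exact
    { mem_maximalIdeal := hzm
      regular := hz
      regular_module := hzω
      mem_conductor := hzc
      injective_base := isInjectiveModulo_quotSMulTop hzS hflS hntS hzS hS
      injective_module := isInjectiveModulo_quotSMulTop hz hflR hntR hzω hω
      socle_base := exists_ne_zero_smul_eq_zero hflS
      socle_module := exists_ne_zero_smul_eq_zero
        (isFiniteLength_of_smul_eq_zero hflR smul_quotSMulTop_eq_zero)
      socle_ring := exists_ne_zero_smul_eq_zero hflR }

end Main

/-- Take a common denominator in S for a finite set of S-module generators of R. -/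
theorem IsBirationalSubring.exists_mem_conductorIdeal {R : Type u} [CommRing R] {S : Subring R}
    (h : IsBirationalSubring S) : ∃ z : S, IsSMulRegular R (algebraMap S R z) ∧
      algebraMap S R z ∈ conductorIdeal S R := by
  classical
  obtain ⟨hfrac, hfin⟩ := h
  have hRinj : Function.Injective (algebraMap R (FractionRing R)) :=
    IsFractionRing.injective R (FractionRing R)
  obtain ⟨T, hT⟩ := hfin.fg_top
  obtain ⟨b, hb⟩ := IsLocalization.exist_integer_multiples_of_finset (nonZeroDivisors S)
    (T.image (algebraMap R (FractionRing R)))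
  refine ⟨b, ?_, fun r => ?_⟩
  · intro x y hxy
    have hu : IsUnit (algebraMap S (FractionRing R) b) := IsLocalization.map_units _ b
    refine hRinj (hu.mul_left_cancel ?_)
    rw [IsScalarTower.algebraMap_apply S R, ← map_mul, ← map_mul]
    exact congrArg _ hxy
  · have hr : r ∈ Submodule.span S (T : Set R) := by rw [hT]; trivial
    induction hr using Submodule.span_induction with
    | mem t ht =>
      obtain ⟨s, hs⟩ := hb _ (Finset.mem_image_of_mem _ ht)
      refine ⟨s, hRinj ?_⟩
      rw [← IsScalarTower.algebraMap_apply, hs, map_mul, Algebra.smul_def,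
        IsScalarTower.algebraMap_apply S R]
    | zero => exact ⟨0, by simp⟩
    | add x y _ _ hx hy =>
      obtain ⟨s, hs⟩ := hx
      obtain ⟨t, ht⟩ := hy
      exact ⟨s + t, by rw [map_add, hs, ht, mul_add]⟩
    | smul a x _ hx =>
      obtain ⟨s, hs⟩ := hx
      exact ⟨a * s, by rw [map_mul, hs, Algebra.smul_def]; ring⟩

theorem length_quotient_traceIdeal_add_one_le_colength {R : Type u} [CommRing R] [IsLocalRing R]
    [IsNoetherianRing R] (hdim : ringKrullDim R = 1) (hG : ¬ IsGorensteinRing R)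
    (ω : Type u) [AddCommGroup ω] [Module R ω] (hω : IsCanonicalModule R ω) (S : Subring R)
    (hS : IsGorensteinRing S) (hSR : IsBirationalSubring S) :
    Module.length R (R ⧸ traceIdeal R ω) + 1 ≤ 2 * colength S := by
  obtain ⟨z, hz, hzc⟩ := hSR.exists_mem_conductorIdeal
  have := hSR.2
  have hinj : Function.Injective (algebraMap S R) := Subtype.val_injective
  have := hS.1
  have := isLocalRing_of_isIntegral hinj
  have hsurj : ¬ Function.Surjective (algebraMap S R) := fun h =>
    hG (hS.of_ringEquiv (RingEquiv.ofBijective (algebraMap S R) ⟨hinj, h⟩))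
  have hzm : z ∈ IsLocalRing.maximalIdeal S := by
    -- A unit of S in the conductor would force S = R, although R is not Gorenstein.
    refine (IsLocalRing.mem_maximalIdeal z).2 fun hu => hsurj ?_
    obtain ⟨y, hy⟩ := hu.exists_right_inv
    intro r
    obtain ⟨s, hs⟩ := hzc r
    exact ⟨y * s, by rw [map_mul, hs, ← mul_assoc, ← map_mul, mul_comm y, hy, map_one, one_mul]⟩
  obtain ⟨n, hn⟩ := hS.exists_hasInjectiveDimensionLE
  obtain ⟨m, hm⟩ := hω.finite_injectiveDimension
  obtain ⟨hfin, rs, hrs, hreg, hlen⟩ := hω.maximalCohenMacaulay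
  have := hreg.nontrivial
  rw [hdim] at hlen
  obtain ⟨r, rfl⟩ : ∃ r, rs = [r] := List.length_eq_one_iff.1 (by exact_mod_cast hlen.symm)
  have hrω := (RingTheory.Sequence.isWeaklyRegular_singleton_iff ω r).1 hreg.1
  have key : ∀ y : S, y ∈ IsLocalRing.maximalIdeal S → IsSMulRegular R (algebraMap S R y) →
      algebraMap S R y ∈ conductorIdeal S R → IsDualizingElement S R ω y := fun y h1 h2 h3 =>
    isDualizingElement hinj hdim.le hn hm (hrs r (by simp)) hrω h1 h2 h3
  exact (key z hzm hz hzc).length_quotient_traceIdeal_add_one_le hinj hsurj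
    (key (z * z) (Ideal.mul_mem_left _ _ hzm) (by rw [map_mul]; exact hz.mul hz)
      (by rw [map_mul]; exact Ideal.mul_mem_left _ _ hzc))

end CanonicalTrace

theorem corollary3p3 {R : Type u} [CommRing R] [IsLocalRing R]
    (hCM : CanonicalTrace.IsCohenMacaulayLocalRing R) (hdim : ringKrullDim R = 1)
    (hG : ¬ CanonicalTrace.IsGorensteinRing R)
    (ω : Type u) [AddCommGroup ω] [Module R ω] (hω : CanonicalTrace.IsCanonicalModule R ω) :
    Module.length R (R ⧸ CanonicalTrace.traceIdeal R ω) + 1 ≤ 2 * CanonicalTrace.bg R := by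
  have := hCM.1
  rcases Set.eq_empty_or_nonempty {n : ℕ∞ | ∃ S : Subring R, CanonicalTrace.IsGorensteinRing S ∧
    CanonicalTrace.IsBirationalSubring S ∧ n = CanonicalTrace.colength S} with h | h
  · rw [CanonicalTrace.bg, h, sInf_empty, ENat.mul_top two_ne_zero]
    exact le_top
  -- ℕ∞ is well-ordered, so the infimum is attained by an actual subring.
  · obtain ⟨S, hS, hSR, hn⟩ := csInf_mem h
    rw [CanonicalTrace.bg, hn]
    exact CanonicalTrace.length_quotient_traceIdeal_add_one_le_colength hdim hG ω hω S hS hSR
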